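/- For an integer matrix $E\in\mathbb Z^{d\times n}$ let $\mathcal G(E)$ be its Graver basis: the set of nonzero $v\in\ker(E)\cap\mathbb Z^n$ that cannot be written as $v=v'+v''$ with nonzero $v',v''\in\ker(E)\cap\mathbb Z^n$ such that $v,v',v''$ lie in a common orthant. For $A\in\mathbb Z^{d_A\times n_A}$, $B\in\mathbb Z^{d_A\times n_B}$, $C\in\mathbb Z^{d_C\times n_B}$, $D\in\mathbb Z^{d_C\times n_A}$ and $N\in\mathbb Z_{\ge0}$ put \[ L_N=\begin{pmatrix}B&A&&\\ \vdots&&\ddots&\\ B&&&A\end{pmatrix},\qquad E_N=\begin{pmatrix}C&D&\cdots&D\\ B&A&&\\ \vdots&&\ddots&\\ B&&&A\end{pmatrix} \] ($N$ copies of $A$, $B$ and $D$). Call $(g,\xi,\eta)\in\mathbb Z_{\ge0}^3$ \emph{stochastic constants} for $(A,B)$ if (a) $\|v\|_\infty\le g$ for all $N$ and all $v\in\mathcal G(L_N)$; (b) consequently $\|v\|_1\le(n_B+Nn_A)g$ for these $v$; (c) there are a set $X\subseteq\mathbb Z^{n_B}$ with $|X|\le\xi$ and sets $Y_x\subseteq\mathbb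 Z^{n_A}$ with $|Y_x|\le\eta$ for $x\in X$, such that for all $N$ every element of $\mathcal G(L_N)$ has the form $(x,y^1,\dots,y^N)$ with $x\in X$ and $y^1,\dots,y^N\in Y_x$. \textbf{Proposition.} Let $A\in\mathbb Z^{d_A\times n_A}$ and $B\in\mathbb Z^{d_A\times n_B}$. Stochastic constants for $(A,B)$ exist. Moreover, for all stochastic constants $(g,\xi_0,\eta)$ for $(A,B)$: (1) There is an integer $\xi\ge\xi_0$, independent of $d_C,C,D,M,N$ (so $(g,\xi,\eta)$ are again stochastic constants), such that for all $d_C\ge1$, $C\in\mathbb Z^{d_C\times n_B}$, $D\in\mathbb Z^{d_C\times n_A}$, every real $M\ge1$ bounding the absolute values of the entries of $C$ and $D$, every $N\in\mathbb Z_{\ge0}$ and every $v\in\mathcal G(E_N)$, \[ \|v\|_1\le \xi\,(N+\eta)^\eta\, d_C\,\bigl(\sqrt{d_C}\,(n_B+Nn_A)M\bigr)^{d_C}\,(n_B+Nn_A)\,g . \] (2) For all $d_C,C,D,M,N,v$ as in (1), \[ \|v\|_1\le \xi_0\,(N+\eta)^\eta\, d_C\,\bigl(\sqrt{d_C}\,(n_B+Nn_A)Mg\bigr)^{d_C}\,(n_B+Nn_A)\,g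 . \] (3) For all $d_C\ge0$ and fixed $C\in\mathbb Z^{d_C\times n_B}$, $D\in\mathbb Z^{d_C\times n_A}$ we have $\max\{\|v\|_1: v\in\mathcal G(E_N)\}=O(N^{d_C+\eta})$ for $N\ge1$ (the maximum over the empty set being $0$). -/

import Mathlib

open Matrix

namespace FourBlock

/-- The `ℓ₁`-norm of an integer vector. -/
def l1 {n : Type*} [Fintype n] (v : n → ℤ) : ℤ := ∑ i, |v i|

/-- The three vectors lie in one common orthant of `ℝⁿ`. -/
def CommonOrthant {n : Type*} (u v w : n → ℤ) : Prop :=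
  ∀ i, (0 ≤ u i ∧ 0 ≤ v i ∧ 0 ≤ w i) ∨ (u i ≤ 0 ∧ v i ≤ 0 ∧ w i ≤ 0)

/-- The Graver basis of an integer matrix `E`: the nonzero integer vectors in the kernel of `E`
that are not a sum of two nonzero integer kernel vectors lying in the same orthant. -/
def graver {m n : Type*} [Fintype n] (E : Matrix m n ℤ) : Set (n → ℤ) :=
  {v | v ≠ 0 ∧ E *ᵥ v = 0 ∧
    ¬ ∃ v' v'' : n → ℤ, v' ≠ 0 ∧ v'' ≠ 0 ∧ E *ᵥ v' = 0 ∧ E *ᵥ v'' = 0 ∧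
      v = v' + v'' ∧ CommonOrthant v v' v''}

/-- The lower blocks: `N` copies of `B` in the first block column, and `N` diagonal copies of `A`.
A column index is `inl j` (a first-stage variable) or `inr (j, k)` (variable `j` of the
`k`-th copy of `A`). -/
def lowerMatrix {dA nA nB : ℕ} (A : Matrix (Fin dA) (Fin nA) ℤ) (B : Matrix (Fin dA) (Fin nB) ℤ)
    (N : ℕ) : Matrix (Fin dA × Fin N) (Fin nB ⊕ Fin nA × Fin N) ℤ :=
  fromCols (of fun p j => B p.1 j) (blockDiagonal fun _ : Fin N => A)

/-- The upper blocks `(C, D, …, D)`. -/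
def upperMatrix {dC nA nB : ℕ} (C : Matrix (Fin dC) (Fin nB) ℤ) (D : Matrix (Fin dC) (Fin nA) ℤ)
    (N : ℕ) : Matrix (Fin dC) (Fin nB ⊕ Fin nA × Fin N) ℤ :=
  fromCols C (of fun i p => D i p.1)

/-- The `N`-fold 4-block matrix with blocks `C, D` (top) and `B, A` (bottom). -/
def fourBlock {dA dC nA nB : ℕ} (A : Matrix (Fin dA) (Fin nA) ℤ) (B : Matrix (Fin dA) (Fin nB) ℤ)
    (C : Matrix (Fin dC) (Fin nB) ℤ) (D : Matrix (Fin dC) (Fin nA) ℤ) (N : ℕ) :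
    Matrix (Fin dC ⊕ Fin dA × Fin N) (Fin nB ⊕ Fin nA × Fin N) ℤ :=
  fromRows (upperMatrix C D N) (lowerMatrix A B N)

/-- `g`, `ξ`, `η` are constants as in the structure theorem for the Graver bases of two-stage
stochastic integer programs: for all `N` simultaneously, Graver basis elements `(x, y¹, …, yᴺ)`
have entries bounded by `g`, their `x` lies in a set `X` of at most `ξ` vectors, and all `yᵏ` lie
in a set `Y x` of at most `η` vectors. -/
structure StochasticConstants {dA nA nB : ℕ} (A : Matrix (Fin dA) (Fin nA) ℤ)
    (B : Matrix (Fin dA) (Fin nB) ℤ) (g ξ η : ℕ) : Prop where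
  entry_le : ∀ (N : ℕ), ∀ v ∈ graver (lowerMatrix A B N), ∀ i, |v i| ≤ (g : ℤ)
  l1_le : ∀ (N : ℕ), ∀ v ∈ graver (lowerMatrix A B N), l1 v ≤ ((nB : ℤ) + N * nA) * g
  building_blocks : ∃ (X : Finset (Fin nB → ℤ)) (Y : (Fin nB → ℤ) → Finset (Fin nA → ℤ)),
    X.card ≤ ξ ∧ (∀ x ∈ X, (Y x).card ≤ η) ∧
    ∀ (N : ℕ), ∀ v ∈ graver (lowerMatrix A B N),
      (fun j => v (Sum.inl j)) ∈ X ∧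
      ∀ k : Fin N, (fun j => v (Sum.inr (j, k))) ∈ Y (fun j => v (Sum.inl j))

end FourBlock

/-!
The constants exist because the antichains in question are finite: conformal order on `ℤⁿ` is a
well-quasi-order, and by Higman's lemma (applied to complements of up-sets, as in Maclagan's
theorem) so is the order on finite sets of bricks `yᵏ` in which every element of the larger set
dominates an element of the smaller one. Infinitely many distinct first stages `x` would then give
two Graver elements of which one contains a smaller kernel vector.

For the bounds, write a Graver element `v` of the four-block matrix as a conformal sum of Graver
elements `u` of the lower blocks. The images of the `u` under the upper blocks `(C, D, …, D)` form
a multiset with sum zero, and minimality of `v` says that no proper part of it sums to zero. By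
Carathéodory, such a multiset with `n` distinct members has at most `n K` members if `K` bounds the
coefficient sums of minimal linear relations (circuits); the coefficients of a circuit are minors,
which Hadamard's inequality estimates. Finally `n` is bounded by counting: the image of
`(x, y¹, …, yᴺ)` depends only on `x` and on the multiset of the `yᵏ`, which is drawn from at most
`η` vectors.
-/

namespace FourBlock

/-! ### Well-quasi-orders on finite sets -/

theorem exists_mem_of_sublistForall₂ {α : Type*} {r : α → α → Prop} {l₁ l₂ : List α}
    (h : List.SublistForall₂ r l₁ l₂) {a : α} (ha : a ∈ l₁) : ∃ b ∈ l₂, r a b := by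
  induction h with
  | nil => simp at ha
  | cons hr _ ih =>
    obtain rfl | ha := List.mem_cons.1 ha
    · exact ⟨_, List.mem_cons_self, hr⟩
    · obtain ⟨b, hb, hab⟩ := ih ha
      exact ⟨b, List.mem_cons_of_mem _ hb, hab⟩
  | cons_right _ ih =>
    obtain ⟨b, hb, hab⟩ := ih ha
    exact ⟨b, List.mem_cons_of_mem _ hb, hab⟩

theorem wellQuasiOrdered_finset_forall_exists {α : Type*} {r : α → α → Prop} [IsPreorder α r]
    (hr : WellQuasiOrdered r) :
    WellQuasiOrdered fun F G : Finset α => ∀ a ∈ F, ∃ b ∈ G, r a b := by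
  intro f
  have higman := Set.PartiallyWellOrderedOn.partiallyWellOrderedOn_sublistForall₂ r
    (Set.partiallyWellOrderedOn_univ_iff.2 hr)
  obtain ⟨i, j, hij, h⟩ := higman.exists_lt (f := fun k => (f k).toList) (by simp)
  exact ⟨i, j, hij, fun a ha => by
    simpa using exists_mem_of_sublistForall₂ h (Finset.mem_toList.2 ha)⟩

theorem exists_finset_boxes_forall_not_le_iff {σ α : Type*} [Finite σ] [LinearOrder α]
    (F : Finset (σ → α)) :
    ∃ 𝓑 : Finset (σ → WithTop α), ∀ x : σ → α,
      (∀ a ∈ F, ¬ a ≤ x) ↔ ∃ β ∈ 𝓑, ∀ i, (x i : WithTop α) < β i := by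
  classical
  cases nonempty_fintype σ
  induction F using Finset.induction_on with
  | empty => exact ⟨{fun _ => ⊤}, fun x => by simp⟩
  | insert a F _ ih =>
    obtain ⟨𝓑, h𝓑⟩ := ih
    refine ⟨(𝓑 ×ˢ Finset.univ).image fun p =>
      Function.update p.1 p.2 (min (p.1 p.2) (a p.2)), fun x => ?_⟩
    rw [Finset.forall_mem_insert, h𝓑]
    simp only [Pi.le_def, not_forall, not_le, Finset.mem_image,
      Finset.mem_product, Finset.mem_univ, and_true, Prod.exists, ↓existsAndEq]
    constructor
    · rintro ⟨⟨i, hi⟩, β, hβ, hx⟩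
      refine ⟨β, i, hβ, fun j => ?_⟩
      obtain rfl | hj := eq_or_ne j i
      · simpa [hi] using hx j
      · simpa [hj] using hx j
    · rintro ⟨β, i, hβ, hx⟩
      have hi : (x i : WithTop α) < β i ∧ x i < a i := by simpa using hx i
      refine ⟨⟨i, hi.2⟩, β, hβ, fun j => ?_⟩
      obtain rfl | hj := eq_or_ne j i
      · exact hi.1
      · simpa [hj] using hx j

/-- If `F` generates a smaller up-set than `G` does, then the complementary union of boxes is
larger, so Higman's lemma applied to the boxes proves this form of Maclagan's theorem. -/
theorem wellQuasiOrdered_finset_pi_forall_exists_le {σ α : Type*} [Finite σ] [LinearOrder α]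
    [WellFoundedLT α] :
    WellQuasiOrdered fun F G : Finset (σ → α) => ∀ b ∈ G, ∃ a ∈ F, a ≤ b := by
  intro f
  choose 𝓑 h𝓑 using fun k => exists_finset_boxes_forall_not_le_iff (f k)
  obtain ⟨i, j, hij, h⟩ := wellQuasiOrdered_finset_forall_exists
    (wellQuasiOrdered_le (α := σ → WithTop α)) 𝓑
  refine ⟨i, j, hij, fun b hb => ?_⟩
  by_contra! hcon
  obtain ⟨β, hβ, hbβ⟩ := (h𝓑 i b).1 hcon
  obtain ⟨γ, hγ, hβγ⟩ := h β hβ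
  exact (h𝓑 j b).2 ⟨γ, hγ, fun s => (hbβ s).trans_le (hβγ s)⟩ b hb le_rfl

/-! ### The conformal order -/

/-- The conformal order `u ⊑ v` on integer vectors: `u` lies in the box spanned by `0` and `v`, that
is, `u` and `v - u` lie in a common orthant with `v`. -/
def ConformalLE {n : Type*} (u v : n → ℤ) : Prop :=
  ∀ i, (0 ≤ u i ∧ u i ≤ v i) ∨ (v i ≤ u i ∧ u i ≤ 0)

section Conformal

variable {n : Type*} {u v w : n → ℤ}

theorem ConformalLE.refl (v : n → ℤ) : ConformalLE v v := fun i => by omega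

theorem ConformalLE.trans (huv : ConformalLE u v) (hvw : ConformalLE v w) :
    ConformalLE u w := fun i => by
  have := huv i
  have := hvw i
  omega

instance : IsPreorder (n → ℤ) ConformalLE where
  refl := .refl
  trans _ _ _ := .trans

theorem conformalLE_iff_commonOrthant : ConformalLE u v ↔ CommonOrthant v u (v - u) :=
  forall_congr' fun i => by
    rw [Pi.sub_apply]
    omega

theorem ConformalLE.sub_left (h : ConformalLE u v) : ConformalLE (v - u) v := fun i => by
  have := h i
  rw [Pi.sub_apply]
  omega

theorem ConformalLE.neg (h : ConformalLE u v) : ConformalLE (-u) (-v) := fun i => by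
  have := h i
  simp only [Pi.neg_apply]
  omega

theorem eq_zero_of_conformalLE_zero (h : ConformalLE u 0) : u = 0 := funext fun i => by
  have := h i
  simp only [Pi.zero_apply] at *
  omega

theorem eq_zero_of_conformalLE_of_conformalLE_neg (h : ConformalLE u v)
    (h' : ConformalLE (-u) v) : u = 0 := funext fun i => by
  have := h i
  have := h' i
  simp only [Pi.zero_apply, Pi.neg_apply] at *
  omega

/-- The positive and negative parts of an integer vector; they embed the conformal order into the
componentwise order on vectors of natural numbers. -/
def signParts (v : n → ℤ) : n ⊕ n → ℕ :=
  Sum.elim (fun i => (v i).toNat) (fun i => (-v i).toNat)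

theorem signParts_le_signParts_iff : signParts u ≤ signParts v ↔ ConformalLE u v := by
  simp only [Pi.le_def, Sum.forall, signParts, Sum.elim_inl, Sum.elim_inr, ← forall_and]
  exact forall_congr' fun i => by omega

theorem wellQuasiOrdered_conformalLE [Finite n] :
    WellQuasiOrdered (ConformalLE : (n → ℤ) → (n → ℤ) → Prop) := fun f => by
  simpa only [signParts_le_signParts_iff] using wellQuasiOrdered_le fun k => signParts (f k)

theorem wellQuasiOrdered_finset_forall_exists_conformalLE [Finite n] :
    WellQuasiOrdered fun F G : Finset (n → ℤ) => ∀ v ∈ G, ∃ u ∈ F, ConformalLE u v := by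
  classical
  intro f
  simpa [signParts_le_signParts_iff] using
    wellQuasiOrdered_finset_pi_forall_exists_le fun k => (f k).image signParts

theorem sum_sameSign_of_conformalLE {s : Multiset (n → ℤ)} (hs : ∀ u ∈ s, ConformalLE u v)
    (i : n) : (0 ≤ v i → 0 ≤ s.sum i) ∧ (v i ≤ 0 → s.sum i ≤ 0) := by
  induction s using Multiset.induction_on with
  | empty => simp
  | cons u s ih =>
    have hu := hs u (Multiset.mem_cons_self u s) i
    have := ih fun w hw => hs w (Multiset.mem_cons_of_mem hw)
    simp only [Multiset.sum_cons, Pi.add_apply]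
    omega

theorem conformalLE_sum_of_le {s t : Multiset (n → ℤ)} (hs : ∀ u ∈ s, ConformalLE u v)
    (hts : t ≤ s) : ConformalLE t.sum s.sum := by
  obtain ⟨t', rfl⟩ := Multiset.le_iff_exists_add.1 hts
  intro i
  have ht := sum_sameSign_of_conformalLE
    (fun u hu => hs u (Multiset.mem_add.2 (Or.inl hu))) i
  have ht' := sum_sameSign_of_conformalLE
    (fun u hu => hs u (Multiset.mem_add.2 (Or.inr hu))) i
  rw [Multiset.sum_add, Pi.add_apply]
  omega

theorem eq_zero_of_sum_eq_zero_of_conformalLE {s : Multiset (n → ℤ)}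
    (hs : ∀ u ∈ s, ConformalLE u v) (h0 : s.sum = 0) {u : n → ℤ} (hu : u ∈ s) : u = 0 := by
  refine eq_zero_of_conformalLE_zero ?_
  simpa [h0] using conformalLE_sum_of_le hs (Multiset.singleton_le.2 hu)

end Conformal

section L1

variable {n : Type*} [Fintype n] {u v : n → ℤ}

theorem l1_pos (hv : v ≠ 0) : 0 < l1 v := by
  obtain ⟨i, hi⟩ := Function.ne_iff.1 hv
  exact Finset.sum_pos' (fun _ _ => abs_nonneg _) ⟨i, Finset.mem_univ i, abs_pos.2 hi⟩

theorem ConformalLE.l1_sub (h : ConformalLE u v) : l1 (v - u) = l1 v - l1 u := by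
  simp only [l1, ← Finset.sum_sub_distrib, Pi.sub_apply]
  refine Finset.sum_congr rfl fun i _ => ?_
  have := h i
  grind

theorem l1_add_le (u v : n → ℤ) : l1 (u + v) ≤ l1 u + l1 v := by
  simp only [l1, ← Finset.sum_add_distrib]
  exact Finset.sum_le_sum fun i _ => abs_add_le _ _

theorem l1_multiset_sum_le {s : Multiset (n → ℤ)} {b : ℤ} (hs : ∀ u ∈ s, l1 u ≤ b) :
    l1 s.sum ≤ s.card * b := by
  have htri : l1 s.sum ≤ (s.map l1).sum :=
    Multiset.le_sum_of_subadditive l1 (by simp [l1]) l1_add_le s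
  simpa using htri.trans (Multiset.sum_le_card_nsmul _ _ (by simpa using hs))

theorem l1_le_card_mul {b : ℤ} (h : ∀ i, |v i| ≤ b) : l1 v ≤ Fintype.card n * b := by
  simpa [l1] using Finset.sum_le_card_nsmul Finset.univ (fun i => |v i|) b fun i _ => h i

theorem abs_mulVec_le {m : Type*} (E : Matrix m n ℤ) (v : n → ℤ) {M : ℝ}
    (hM : ∀ i j, |(E i j : ℝ)| ≤ M) (i : m) : |((E *ᵥ v) i : ℝ)| ≤ M * l1 v := by
  simp only [mulVec, dotProduct, l1, Int.cast_sum, Int.cast_mul, Int.cast_abs, Finset.mul_sum]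
  refine (Finset.abs_sum_le_sum_abs _ _).trans (Finset.sum_le_sum fun j _ => ?_)
  rw [abs_mul]
  exact mul_le_mul_of_nonneg_right (hM i j) (abs_nonneg _)

end L1

/-! ### Graver bases -/

section Graver

variable {m n : Type*} [Fintype n] {E : Matrix m n ℤ} {v : n → ℤ}

theorem mem_graver_iff_minimal :
    v ∈ graver E ↔ v ≠ 0 ∧ E *ᵥ v = 0 ∧
      ∀ u, u ≠ 0 → E *ᵥ u = 0 → ConformalLE u v → u = v := by
  refine and_congr_right fun _ => and_congr_right fun hEv => ?_
  constructor
  · intro hirr u hu hEu huv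
    by_contra hne
    exact hirr ⟨u, v - u, hu, sub_ne_zero.2 (Ne.symm hne), hEu, by simp [mulVec_sub, hEv, hEu],
      by simp, conformalLE_iff_commonOrthant.1 huv⟩
  · rintro hmin ⟨u, w, hu, hw, hEu, -, rfl, horth⟩
    have huw : ConformalLE u (u + w) := conformalLE_iff_commonOrthant.2 (by simpa using horth)
    exact hw (by simpa using (hmin u hu hEu huw).symm)

theorem neg_mem_graver (hv : v ∈ graver E) : -v ∈ graver E := by
  rw [mem_graver_iff_minimal] at hv ⊢
  obtain ⟨hv0, hEv, hmin⟩ := hv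
  refine ⟨neg_ne_zero.2 hv0, by rw [mulVec_neg, hEv, neg_zero], fun u hu hEu huv => ?_⟩
  rw [← hmin (-u) (neg_ne_zero.2 hu) (by rw [mulVec_neg, hEu, neg_zero]) (by simpa using huv.neg),
    neg_neg]

theorem exists_multiset_graver_sum_eq (hv : E *ᵥ v = 0) :
    ∃ s : Multiset (n → ℤ), (∀ u ∈ s, u ∈ graver E ∧ ConformalLE u v) ∧ s.sum = v := by
  induction hl : (l1 v).toNat using Nat.strong_induction_on generalizing v with
  | _ k ih =>
  by_cases h0 : v = 0
  · exact ⟨0, by simp, by simp [h0]⟩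
  by_cases hg : v ∈ graver E
  · exact ⟨{v}, by simpa using ⟨hg, .refl v⟩, Multiset.sum_singleton v⟩
  simp only [mem_graver_iff_minimal, h0, hv, ne_eq, not_false_eq_true, true_and] at hg
  push Not at hg
  obtain ⟨u, hu0, hEu, huv, hne⟩ := hg
  have hl1 := huv.l1_sub
  have hu := l1_pos hu0
  have hvu := l1_pos (sub_ne_zero.2 (Ne.symm hne))
  obtain ⟨s, hs, hsu⟩ := ih _ (by omega) hEu rfl
  obtain ⟨t, ht, htu⟩ := ih _ (by omega) (v := v - u) (by rw [mulVec_sub, hv, hEu, sub_zero]) rfl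
  refine ⟨s + t, fun w hw => ?_, by rw [Multiset.sum_add, hsu, htu, add_sub_cancel]⟩
  obtain hw | hw := Multiset.mem_add.1 hw
  · exact ⟨(hs w hw).1, (hs w hw).2.trans huv⟩
  · exact ⟨(ht w hw).1, (ht w hw).2.trans huv.sub_left⟩

theorem exists_mem_graver_of_mulVec_eq_zero (hv0 : v ≠ 0) (hv : E *ᵥ v = 0) :
    ∃ u, u ∈ graver E := by
  obtain ⟨s, hs, rfl⟩ := exists_multiset_graver_sum_eq hv
  obtain ⟨u, hu⟩ := Multiset.exists_mem_of_ne_zero (by rintro rfl; simp at hv0 : s ≠ 0)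
  exact ⟨u, (hs u hu).1⟩

end Graver

/-! ### The structure theorem for two-stage Graver bases -/

section Stages

variable {dA nA nB N : ℕ} {A : Matrix (Fin dA) (Fin nA) ℤ} {B : Matrix (Fin dA) (Fin nB) ℤ}

/-- The first-stage part `x` of a vector `(x, y¹, …, yᴺ)`. -/
def firstStage (v : Fin nB ⊕ Fin nA × Fin N → ℤ) : Fin nB → ℤ := fun j => v (Sum.inl j)

/-- The `k`-th second-stage part `yᵏ` of a vector `(x, y¹, …, yᴺ)`. -/
def brick (v : Fin nB ⊕ Fin nA × Fin N → ℤ) (k : Fin N) : Fin nA → ℤ := fun j => v (Sum.inr (j, k))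

theorem lowerMatrix_mulVec_eq_zero_iff {v : Fin nB ⊕ Fin nA × Fin N → ℤ} :
    lowerMatrix A B N *ᵥ v = 0 ↔ ∀ k, B *ᵥ firstStage v + A *ᵥ brick v k = 0 := by
  simp only [funext_iff, Prod.forall, lowerMatrix, mulVec, dotProduct, fromCols, of_apply,
    Fintype.sum_sum_type, Sum.elim_inl, Sum.elim_inr, Fintype.sum_prod_type, blockDiagonal_apply,
    Pi.add_apply, Pi.zero_apply, ite_mul, zero_mul, Finset.sum_ite_eq, Finset.mem_univ, if_true]
  exact forall_comm

theorem eq_of_mem_graver_lowerMatrix {v : Fin nB ⊕ Fin nA × Fin N → ℤ}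
    (hv : v ∈ graver (lowerMatrix A B N)) {x : Fin nB → ℤ} {y : Fin N → Fin nA → ℤ}
    (hx : ConformalLE x (firstStage v)) (hy : ∀ k, ConformalLE (y k) (brick v k))
    (hker : ∀ k, B *ᵥ x + A *ᵥ y k = 0) (h0 : x ≠ 0 ∨ ∃ k, y k ≠ 0) :
    x = firstStage v ∧ ∀ k, y k = brick v k := by
  let u : Fin nB ⊕ Fin nA × Fin N → ℤ := Sum.elim x fun p => y p.2 p.1
  have hu0 : u ≠ 0 := by
    rintro hu
    have hx0 : x = 0 := congrArg firstStage hu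
    have hy0 : ∀ k, y k = 0 := fun k => congrArg (brick · k) hu
    simp [hx0, hy0] at h0
  have huv : u = v := (mem_graver_iff_minimal.1 hv).2.2 u hu0
    (lowerMatrix_mulVec_eq_zero_iff.2 hker) (Sum.forall.2 ⟨hx, fun p => hy p.2 p.1⟩)
  exact huv ▸ ⟨rfl, fun _ => rfl⟩

theorem finite_firstStage_graver (A : Matrix (Fin dA) (Fin nA) ℤ)
    (B : Matrix (Fin dA) (Fin nB) ℤ) :
    {x : Fin nB → ℤ | ∃ N, ∃ v ∈ graver (lowerMatrix A B N), firstStage v = x}.Finite := by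
  refine Set.Finite.of_sdiff (t := {0}) ?_ (Set.finite_singleton 0)
  by_contra hinf
  let x := Set.Infinite.natEmbedding _ hinf
  choose N v hv hvx using fun k => (x k).2.1
  obtain ⟨a, b, hab, hfirst, hbricks⟩ := wellQuasiOrdered_conformalLE.prod
    wellQuasiOrdered_finset_forall_exists_conformalLE
    fun k => (firstStage (v k), Finset.univ.image (brick (v k)))
  simp only [Finset.mem_image, Finset.mem_univ, true_and, exists_exists_eq_and,
    forall_exists_index, forall_apply_eq_imp_iff] at hbricks
  choose c hc using hbricks
  have heq : firstStage (v a) = firstStage (v b) :=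
    (eq_of_mem_graver_lowerMatrix (hv b) hfirst hc
      (fun k => lowerMatrix_mulVec_eq_zero_iff.1 (hv a).2.1 (c k))
      (Or.inl fun h0 => (x a).2.2 (hvx a ▸ h0))).1
  exact hab.ne (x.injective (Subtype.ext (by rw [← hvx a, ← hvx b, heq])))

theorem finite_brick_graver (A : Matrix (Fin dA) (Fin nA) ℤ)
    (B : Matrix (Fin dA) (Fin nB) ℤ) (x : Fin nB → ℤ) :
    {y : Fin nA → ℤ | ∃ N, ∃ v ∈ graver (lowerMatrix A B N), firstStage v = x ∧
      ∃ k, brick v k = y}.Finite := by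
  refine Set.Finite.of_sdiff (t := {0}) (IsAntichain.finite_of_wellQuasiOrdered ?_
    wellQuasiOrdered_conformalLE) (Set.finite_singleton 0)
  rintro _ ⟨⟨N, v, hv, rfl, k, rfl⟩, hy0⟩ _ ⟨⟨N', v', hv', hx, k', rfl⟩, -⟩ hne hle
  refine hne ?_
  have hswap := (eq_of_mem_graver_lowerMatrix hv' (x := firstStage v)
    (y := Function.update (brick v') k' (brick v k)) (hx ▸ .refl _) (fun c => ?_) (fun c => ?_)
    (Or.inr ⟨k', by simpa using hy0⟩)).2 k'
  · simpa using hswap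
  · obtain rfl | hc := eq_or_ne c k'
    · simpa using hle
    · simpa [hc] using .refl _
  · obtain rfl | hc := eq_or_ne c k'
    · simpa using lowerMatrix_mulVec_eq_zero_iff.1 hv.2.1 k
    · simpa [hc, hx] using lowerMatrix_mulVec_eq_zero_iff.1 hv'.2.1 c

theorem exists_nat_abs_le_of_finset {n : Type*} [Finite n] (F : Finset (n → ℤ)) :
    ∃ g : ℕ, ∀ v ∈ F, ∀ i, |v i| ≤ (g : ℤ) := by
  cases nonempty_fintype n
  refine ⟨F.sup fun v => Finset.univ.sup fun i => (v i).natAbs, fun v hv i => ?_⟩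
  rw [Int.abs_eq_natAbs, Nat.cast_le]
  exact (Finset.le_sup (f := fun i => (v i).natAbs) (Finset.mem_univ i)).trans
    (Finset.le_sup (f := fun v : n → ℤ => Finset.univ.sup fun i => (v i).natAbs) hv)

theorem exists_stochasticConstants (A : Matrix (Fin dA) (Fin nA) ℤ)
    (B : Matrix (Fin dA) (Fin nB) ℤ) : ∃ g ξ η : ℕ, StochasticConstants A B g ξ η := by
  classical
  let X := (finite_firstStage_graver A B).toFinset
  let Y := fun x => (finite_brick_graver A B x).toFinset
  have hX : ∀ N, ∀ v ∈ graver (lowerMatrix A B N), firstStage v ∈ X :=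
    fun N v hv => (Set.Finite.mem_toFinset _).2 ⟨N, v, hv, rfl⟩
  have hY : ∀ N, ∀ v ∈ graver (lowerMatrix A B N), ∀ k, brick v k ∈ Y (firstStage v) :=
    fun N v hv k => (Set.Finite.mem_toFinset _).2 ⟨N, v, hv, rfl, k, rfl⟩
  obtain ⟨gX, hgX⟩ := exists_nat_abs_le_of_finset X
  obtain ⟨gY, hgY⟩ := exists_nat_abs_le_of_finset (X.biUnion Y)
  have hentry : ∀ N, ∀ v ∈ graver (lowerMatrix A B N), ∀ i, |v i| ≤ ((max gX gY : ℕ) : ℤ) := by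
    rintro N v hv (j | ⟨j, k⟩)
    · exact (hgX _ (hX N v hv) j).trans (by simp)
    · exact (hgY _ (Finset.mem_biUnion.2 ⟨_, hX N v hv, hY N v hv k⟩) j).trans (by simp)
  exact ⟨max gX gY, X.card, X.sup fun x => (Y x).card, hentry,
    fun N v hv => (l1_le_card_mul (hentry N v hv)).trans_eq (by simp [mul_comm]),
    X, Y, le_rfl, fun x hx => Finset.le_sup (f := fun x => (Y x).card) hx,
    fun N v hv => ⟨hX N v hv, hY N v hv⟩⟩

end Stages

/-! ### Determinants and one-dimensional kernels -/

section Determinant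

variable {ι : Type*} [Fintype ι] [DecidableEq ι]

theorem abs_det_le_prod_norm_row (Q : Matrix ι ι ℝ) : |Q.det| ≤ ∏ i, ‖WithLp.toLp 2 (Q i)‖ := by
  let b := (EuclideanSpace.basisFun ι ℝ).reindex (Fintype.equivFin ι)
  have : Fact (Module.finrank ℝ (EuclideanSpace ℝ ι) = Fintype.card ι) := ⟨by simp⟩
  let e := (Fintype.equivFin ι).symm
  have hdet : b.toBasis.det (fun k => WithLp.toLp 2 (Q (e k))) = Q.det := by
    rw [Module.Basis.det_apply, ← det_transpose, ← det_submatrix_equiv_self e Q]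
    rfl
  rw [← hdet, ← b.toBasis.orientation.volumeForm_robust b rfl, ← e.prod_comp]
  exact Orientation.abs_volumeForm_apply_le _ _

theorem abs_det_le_sqrt_card_mul_pow {Q : Matrix ι ι ℝ} {m : ℝ} (hm : ∀ i j, |Q i j| ≤ m) :
    |Q.det| ≤ (√(Fintype.card ι) * m) ^ Fintype.card ι := by
  have hrow : ∀ i, ‖WithLp.toLp 2 (Q i)‖ ≤ √(Fintype.card ι) * m := fun i => by
    have hm0 : 0 ≤ m := (abs_nonneg _).trans (hm i i)
    rw [EuclideanSpace.norm_eq, Real.sqrt_le_left (by positivity), mul_pow,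
      Real.sq_sqrt (Nat.cast_nonneg _)]
    simpa using Finset.sum_le_card_nsmul Finset.univ (fun j => Q i j ^ 2) (m ^ 2)
      fun j _ => sq_le_sq.2 ((hm i j).trans (le_abs_self m))
  simpa using (abs_det_le_prod_norm_row Q).trans
    (Finset.prod_le_prod (fun i _ => norm_nonneg _) fun i _ => hrow i)

theorem exists_submatrix_det_ne_zero {κ K : Type*} [Finite κ] [Field K] {P : Matrix κ ι K}
    (hP : LinearIndependent K P.col) : ∃ a : ι → κ, (P.submatrix a id).det ≠ 0 := by
  cases nonempty_fintype κ
  obtain ⟨τ, a, ha, hspan, hli⟩ := exists_linearIndependent' K P.row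
  have : Fintype τ := .ofInjective a ha
  have hcard : Fintype.card ι = Fintype.card τ := by
    rw [← finrank_span_eq_card hli, hspan, ← rank_eq_finrank_span_row, ← rank_transpose]
    exact (LinearIndependent.rank_matrix hP).symm
  let e : ι ≃ τ := Fintype.equivOfCardEq hcard
  have hrows : LinearIndependent K (P.submatrix (a ∘ e) id).row := hli.comp e e.injective
  exact ⟨a ∘ e,
    ((isUnit_iff_isUnit_det _).1 (linearIndependent_rows_iff_isUnit.1 hrows)).ne_zero⟩

end Determinant

section SignedMinors

variable {R : Type*} [CommRing R] {k : ℕ}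

/-- The signed maximal minors of a `k × (k + 1)` matrix, a generator of its kernel when the rank is
`k`. -/
def signedMinors (Q : Matrix (Fin k) (Fin (k + 1)) R) : Fin (k + 1) → R :=
  fun t => (-1) ^ (t : ℕ) * (Q.submatrix id t.succAbove).det

theorem mulVec_signedMinors (Q : Matrix (Fin k) (Fin (k + 1)) R) : Q *ᵥ signedMinors Q = 0 := by
  ext r
  -- Laplace expansion of `Q` with row `r` repeated on top
  have hrepeat : (of (Fin.cons (Q r) Q : Fin (k + 1) → Fin (k + 1) → R)).det = 0 :=
    det_zero_of_row_eq (Fin.succ_ne_zero r).symm rfl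
  rw [det_succ_row_zero] at hrepeat
  rw [Pi.zero_apply, ← hrepeat, mulVec, dotProduct]
  refine Finset.sum_congr rfl fun t _ => ?_
  rw [signedMinors, mul_left_comm, mul_assoc]
  rfl

theorem signedMinors_map {S : Type*} [CommRing S] (φ : R →+* S) (Q : Matrix (Fin k) (Fin (k + 1)) R)
    (t : Fin (k + 1)) : signedMinors (Q.map φ) t = φ (signedMinors Q t) := by
  simp [signedMinors, RingHom.map_det, submatrix_map]

theorem smul_signedMinors_eq [IsDomain R] {Q : Matrix (Fin k) (Fin (k + 1)) R}
    (hQ : (Q.submatrix id Fin.succ).det ≠ 0) {w : Fin (k + 1) → R} (hw : Q *ᵥ w = 0) :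
    w 0 • signedMinors Q = signedMinors Q 0 • w := by
  set d := w 0 • signedMinors Q - signedMinors Q 0 • w with hd
  have hQd : Q *ᵥ d = 0 := by
    simp only [hd, mulVec_sub, mulVec_smul, mulVec_signedMinors, hw, smul_zero, sub_zero]
  have hd0 : d 0 = 0 := by simp [hd, mul_comm]
  have htail : Q.submatrix id Fin.succ *ᵥ (fun t => d t.succ) = 0 := by
    ext r
    simpa [mulVec, dotProduct, Fin.sum_univ_succ, hd0] using congrFun hQd r
  refine sub_eq_zero.1 (funext (Fin.cases hd0 fun t => ?_))
  exact congrFun (eq_zero_of_mulVec_eq_zero hQ htail) t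

end SignedMinors

/-! ### Circuits -/

/-- Carathéodory's theorem: the origin lies in the convex hull of the vectors involved. -/
theorem exists_pos_relation_linearIndependent {ι 𝕜 V : Type*} [Fintype ι] [Field 𝕜]
    [LinearOrder 𝕜] [IsStrictOrderedRing 𝕜] [AddCommGroup V] [Module 𝕜 V] {x : ι → V} {l : ι → 𝕜}
    (hl : 0 ≤ l) (hl0 : l ≠ 0) (hrel : ∑ i, l i • x i = 0) :
    ∃ (k : ℕ) (σ : Fin (k + 1) → ι) (w : Fin (k + 1) → 𝕜), (∀ t, l (σ t) ≠ 0) ∧ (∀ t, 0 < w t) ∧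
      ∑ t, w t • x (σ t) = 0 ∧ LinearIndependent 𝕜 fun t : Fin k => x (σ t.succ) := by
  classical
  obtain ⟨i₀, hi₀⟩ := Function.ne_iff.1 hl0
  have hmem : (0 : V) ∈ convexHull 𝕜 (x '' {i | l i ≠ 0}) := by
    have hpos : 0 < ∑ i ∈ Finset.univ.filter (l · ≠ 0), l i := Finset.sum_pos'
      (fun i _ => hl i) ⟨i₀, by simpa using hi₀, (hl i₀).lt_of_ne' hi₀⟩
    have hcenter := Finset.centerMass_mem_convexHull (s := x '' {i | l i ≠ 0}) _
      (fun i _ => hl i) hpos fun i hi => Set.mem_image_of_mem x (Finset.mem_filter.1 hi).2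
    rwa [Finset.centerMass_filter_ne_zero, Finset.centerMass, hrel, smul_zero] at hcenter
  obtain ⟨τ, _, z, w, hz, haff, hw, hsum, hzero⟩ := eq_pos_convex_span_of_mem_convexHull hmem
  have : Nonempty τ := not_isEmpty_iff.1 fun _ => by simp at hsum
  obtain ⟨k, hk⟩ := Nat.exists_eq_succ_of_ne_zero (Fintype.card_ne_zero (α := τ))
  let e : Fin (k + 1) ≃ τ := (Fintype.equivFinOfCardEq hk).symm
  choose σ hσl hσz using fun t => hz (Set.mem_range_self (e t))
  have hzσ : z ∘ e = x ∘ σ := funext fun t => (hσz t).symm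
  replace haff : AffineIndependent 𝕜 (x ∘ σ) := hzσ ▸ haff.comp_embedding e.toEmbedding
  replace hsum : ∑ t, w (e t) = 1 := by rw [e.sum_comp w, hsum]
  replace hzero : ∑ t, w (e t) • x (σ t) = 0 := by
    simpa only [hσz, e.sum_comp fun i => w i • z i] using hzero
  refine ⟨k, σ, w ∘ e, hσl, fun t => hw _, hzero, Fintype.linearIndependent_iff.2 fun c hc => ?_⟩
  -- subtracting a multiple of `w` turns a linear relation into an affine one
  let u : Fin (k + 1) → 𝕜 := fun t =>
    (Fin.cons 0 c : Fin (k + 1) → 𝕜) t - (∑ s, c s) * w (e t)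
  have hu : ∀ t, u t = 0 := fun t => by
    refine affineIndependent_iff.1 haff Finset.univ u ?_ ?_ t (Finset.mem_univ t)
    · simp only [u, Finset.sum_sub_distrib, ← Finset.mul_sum, hsum]
      simp [Fin.sum_univ_succ]
    · simp only [u, sub_smul, Finset.sum_sub_distrib, mul_smul, ← Finset.smul_sum,
        Function.comp_apply, hzero]
      simp [Fin.sum_univ_succ, hc]
  have hc0 : ∑ s, c s = 0 := by simpa [u, (hw _).ne'] using hu 0
  exact fun t => by simpa [u, hc0] using hu t.succ

/-- The bound `(k + 1) (√k m)ᵏ` on the coefficient sum of a circuit of rank `k` among vectors with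
entries of absolute value at most `m`: each of its `k + 1` coefficients is a `k × k` minor, which is
estimated by Hadamard's inequality. -/
noncomputable def circuitBound (k : ℕ) (m : ℝ) : ℝ := (k + 1) * (√k * m) ^ k

section CircuitBound

variable {k d : ℕ} {m m' : ℝ}

theorem circuitBound_nonneg (k : ℕ) (hm : 0 ≤ m) : 0 ≤ circuitBound k m := by
  unfold circuitBound
  positivity

theorem sqrt_mul_pow_le_sqrt_mul_pow (hkd : k ≤ d) (hm : 1 ≤ m) :
    (√k * m) ^ k ≤ (√d * m) ^ d := by
  obtain rfl | hd := Nat.eq_zero_or_pos d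
  · rw [Nat.le_zero.1 hkd]
  have hsqrt : 1 ≤ √(d : ℝ) := Real.one_le_sqrt.2 (mod_cast hd)
  calc (√k * m) ^ k ≤ (√d * m) ^ k := by gcongr
    _ ≤ (√d * m) ^ d := pow_le_pow_right₀ (one_le_mul_of_one_le_of_one_le hsqrt hm) hkd

theorem circuitBound_mono (hkd : k ≤ d) (hm : 1 ≤ m) (hmm' : m ≤ m') :
    circuitBound k m ≤ circuitBound d m' := by
  have : 0 ≤ m := zero_le_one.trans hm
  calc circuitBound k m ≤ (d + 1) * (√d * m) ^ d := by
        unfold circuitBound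
        gcongr
        exact sqrt_mul_pow_le_sqrt_mul_pow hkd hm
    _ ≤ circuitBound d m' := by
        unfold circuitBound
        gcongr

theorem circuitBound_mul (k : ℕ) (a m : ℝ) :
    circuitBound k (a * m) = a ^ k * circuitBound k m := by
  unfold circuitBound
  ring

theorem circuitBound_le_two_mul (hd : 1 ≤ d) (hm : 0 ≤ m) :
    circuitBound d m ≤ 2 * (d * (√d * m) ^ d) := by
  have hd' : (1 : ℝ) ≤ d := mod_cast hd
  rw [circuitBound, ← mul_assoc]
  gcongr
  linarith

end CircuitBound

section Relations

variable {ι κ : Type*}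

theorem sum_nsmul_eq_zero_iff_sum_cast_smul_eq_zero [Fintype ι] {f : ι → κ → ℤ} {c : ι → ℕ} :
    ∑ i, c i • f i = 0 ↔ ∑ i, (c i : ℝ) • (fun j => (f i j : ℝ)) = 0 := by
  simp only [funext_iff, Finset.sum_apply, Pi.smul_apply, nsmul_eq_mul, smul_eq_mul, Pi.zero_apply]
  exact forall_congr' fun j => by exact_mod_cast Iff.rfl

theorem exists_nat_relation_of_pos_relation [Finite κ] {k : ℕ} {x : Fin (k + 1) → κ → ℤ} {m : ℝ}
    (hm : ∀ t j, |(x t j : ℝ)| ≤ m) {w : Fin (k + 1) → ℝ} (hw : ∀ t, 0 < w t)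
    (hrel : ∑ t, w t • (fun j => (x t j : ℝ)) = 0)
    (hli : LinearIndependent ℝ fun (t : Fin k) j => (x t.succ j : ℝ)) :
    ∃ c : Fin (k + 1) → ℕ, c ≠ 0 ∧ ∑ t, c t • x t = 0 ∧ ∑ t, (c t : ℝ) ≤ circuitBound k m := by
  obtain ⟨a, ha⟩ := exists_submatrix_det_ne_zero (P := of fun j (t : Fin k) => (x t.succ j : ℝ)) hli
  let Q : Matrix (Fin k) (Fin (k + 1)) ℝ := of fun r t => (x t (a r) : ℝ)
  let q : Fin (k + 1) → ℤ := signedMinors (of fun r t => x t (a r))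
  have hq : ∀ t, signedMinors Q t = q t := signedMinors_map (Int.castRingHom ℝ) _
  have hQ : (Q.submatrix id Fin.succ).det ≠ 0 := ha
  have hQw : Q *ᵥ w = 0 := funext fun r => by
    simpa [Q, mulVec, dotProduct, mul_comm] using congrFun hrel (a r)
  -- the minors are proportional to `w`, hence nonzero and all of the same sign
  have habs : ∀ t, ((q t).natAbs : ℝ) = |signedMinors Q 0| / w 0 * w t := fun t => by
    have hprop : w 0 * signedMinors Q t = signedMinors Q 0 * w t :=
      congrFun (smul_signedMinors_eq hQ hQw) t
    rw [Nat.cast_natAbs, Int.cast_abs, ← hq, div_mul_eq_mul_div, eq_div_iff (hw 0).ne']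
    simpa [abs_mul, abs_of_pos, hw, mul_comm] using congrArg abs hprop
  have hHadamard : ∀ t, ((q t).natAbs : ℝ) ≤ (√k * m) ^ k := fun t => by
    rw [Nat.cast_natAbs, Int.cast_abs, ← hq]
    simpa [signedMinors, abs_mul, Q] using abs_det_le_sqrt_card_mul_pow
      (Q := Q.submatrix id t.succAbove) fun r s => hm (t.succAbove s) (a r)
  refine ⟨fun t => (q t).natAbs, fun h => ?_, ?_, ?_⟩
  · have hq0 : q 0 = 0 := Int.natAbs_eq_zero.1 (congrFun h 0)
    exact hQ (by simpa [signedMinors, hq0] using hq 0)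
  · simp only [sum_nsmul_eq_zero_iff_sum_cast_smul_eq_zero, habs, mul_smul, ← Finset.smul_sum, hrel,
      smul_zero]
  · simpa [circuitBound] using Finset.sum_le_card_nsmul Finset.univ _ _ fun t _ => hHadamard t

theorem exists_circuit [Fintype ι] [Finite κ] {f : ι → κ → ℤ} {m : ℝ} (hm1 : 1 ≤ m)
    (hm : ∀ i j, |(f i j : ℝ)| ≤ m) {W : Submodule ℝ (κ → ℝ)}
    (hW : ∀ i, (fun j => (f i j : ℝ)) ∈ W) {l : ι → ℝ} (hl : 0 ≤ l) (hl0 : l ≠ 0)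
    (hrel : ∑ i, l i • (fun j => (f i j : ℝ)) = 0) :
    ∃ c : ι → ℕ, c ≠ 0 ∧ (∀ i, c i ≠ 0 → l i ≠ 0) ∧ ∑ i, c i • f i = 0 ∧
      ∑ i, (c i : ℝ) ≤ circuitBound (Module.finrank ℝ W) m := by
  classical
  obtain ⟨k, σ, w, hσ, hw, hrelσ, hli⟩ := exists_pos_relation_linearIndependent hl hl0 hrel
  obtain ⟨c, hc0, hcrel, hcK⟩ :=
    exists_nat_relation_of_pos_relation (fun t => hm (σ t)) hw hrelσ hli
  have hk : k ≤ Module.finrank ℝ W := by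
    have hliW : LinearIndependent ℝ fun t : Fin k => (⟨_, hW (σ t.succ)⟩ : W) :=
      .of_comp W.subtype hli
    simpa using hliW.fintype_card_le_finrank
  refine ⟨fun i => ∑ t with σ t = i, c t, fun h => hc0 (funext fun t => ?_), fun i hi => ?_, ?_, ?_⟩
  · exact Finset.sum_eq_zero_iff.1 (congrFun h (σ t)) t (by simp)
  · obtain ⟨t, ht, -⟩ := Finset.exists_ne_zero_of_sum_ne_zero hi
    exact (Finset.mem_filter.1 ht).2 ▸ hσ t
  · rw [← hcrel, ← Finset.sum_fiberwise Finset.univ σ]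
    refine Finset.sum_congr rfl fun i _ => ?_
    rw [Finset.sum_smul]
    exact Finset.sum_congr rfl fun t ht => by rw [(Finset.mem_filter.1 ht).2]
  · rw [← Nat.cast_sum, Finset.sum_fiberwise Finset.univ σ c, Nat.cast_sum]
    exact hcK.trans (circuitBound_mono hk hm1 le_rfl)

theorem exists_smul_le_of_support_subset [Finite ι] {𝕜 : Type*} [Field 𝕜] [LinearOrder 𝕜]
    [IsStrictOrderedRing 𝕜] {l c : ι → 𝕜} (hl : 0 ≤ l) (hc : 0 ≤ c) (hc0 : c ≠ 0)
    (hsupp : ∀ i, c i ≠ 0 → l i ≠ 0) :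
    ∃ α : 𝕜, 0 ≤ α ∧ α • c ≤ l ∧ ∃ i, l i ≠ 0 ∧ (α • c) i = l i := by
  obtain ⟨i₀, hi₀⟩ := Function.ne_iff.1 hc0
  obtain ⟨i, hi, hmin⟩ := Set.exists_min_image {i | c i ≠ 0} (fun i => l i / c i)
    (Set.toFinite _) ⟨i₀, hi₀⟩
  refine ⟨l i / c i, div_nonneg (hl i) (hc i), fun j => ?_, i, hsupp i hi, div_mul_cancel₀ _ hi⟩
  by_cases hj : c j = 0
  · simpa [hj] using hl j
  · exact (le_div_iff₀ ((hc j).lt_of_ne' hj)).1 (hmin j hj)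

/-- Subtracting a maximal multiple of a circuit from `l` kills a coordinate and reduces `∑ i, l i`
by at most `circuitBound`. -/
theorem sum_le_card_mul_circuitBound [Fintype ι] [Finite κ] {f : ι → κ → ℤ} {m : ℝ} (hm1 : 1 ≤ m)
    (hm : ∀ i j, |(f i j : ℝ)| ≤ m) {W : Submodule ℝ (κ → ℝ)}
    (hW : ∀ i, (fun j => (f i j : ℝ)) ∈ W) {l : ι → ℝ} (hl : 0 ≤ l)
    (hrel : ∑ i, l i • (fun j => (f i j : ℝ)) = 0)
    (hirr : ∀ c : ι → ℕ, c ≠ 0 → ∑ i, c i • f i = 0 → ∀ α : ℝ,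
      α • (fun i => (c i : ℝ)) ≤ l → α ≤ 1)
    {S : Finset ι} (hS : ∀ i, l i ≠ 0 → i ∈ S) :
    ∑ i, l i ≤ S.card * circuitBound (Module.finrank ℝ W) m := by
  classical
  set K := circuitBound (Module.finrank ℝ W) m
  have hK : 0 ≤ K := circuitBound_nonneg _ (zero_le_one.trans hm1)
  induction S using Finset.strongInduction generalizing l with
  | _ S ih =>
  by_cases hl0 : l = 0
  · simpa [hl0] using mul_nonneg S.card.cast_nonneg hK
  obtain ⟨c, hc0, hcl, hcrel, hcK⟩ := exists_circuit hm1 hm hW hl hl0 hrel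
  let c' : ι → ℝ := fun i => c i
  obtain ⟨α, hα, hle, i, hi, hi'⟩ := exists_smul_le_of_support_subset (c := c') hl
    (fun i => Nat.cast_nonneg _) (fun h => hc0 (funext fun i => by simpa [c'] using congrFun h i))
    (fun i hi => hcl i (by simpa [c'] using hi))
  have hα1 : α ≤ 1 := hirr c hc0 hcrel α hle
  have hc'rel : ∑ i, c' i • (fun j => (f i j : ℝ)) = 0 :=
    sum_nsmul_eq_zero_iff_sum_cast_smul_eq_zero.1 hcrel
  have hle' : l - α • c' ≤ l := sub_le_self l (smul_nonneg hα fun i => Nat.cast_nonneg (c i))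
  have hrest := ih (S.erase i) (Finset.erase_ssubset (hS i hi)) (l := l - α • c') (sub_nonneg.2 hle)
    (by simp [sub_smul, hrel, mul_smul, ← Finset.smul_sum, hc'rel])
    (fun d hd0 hd β hβ => hirr d hd0 hd β (hβ.trans hle')) (fun j hj => ?_)
  · have hα_circuit : α * ∑ i, c' i ≤ K :=
      (mul_le_of_le_one_left (Finset.sum_nonneg fun _ _ => Nat.cast_nonneg _) hα1).trans hcK
    rw [Finset.cast_card_erase_of_mem (hS i hi)] at hrest
    simp only [Pi.sub_apply, Pi.smul_apply, smul_eq_mul, Finset.sum_sub_distrib,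
      ← Finset.mul_sum] at hrest
    linarith
  · refine Finset.mem_erase.2 ⟨?_, hS j fun h0 => hj (le_antisymm ((hle' j).trans h0.le) ?_)⟩
    · rintro rfl
      exact hj (by rw [Pi.sub_apply, hi', sub_self])
    · exact sub_nonneg.2 (hle j)

theorem card_le_card_toFinset_mul_circuitBound [Finite κ] [DecidableEq (κ → ℤ)]
    {T : Multiset (κ → ℤ)} {m : ℝ} (hm1 : 1 ≤ m) (hm : ∀ x ∈ T, ∀ j, |(x j : ℝ)| ≤ m)
    {W : Submodule ℝ (κ → ℝ)} (hW : ∀ x ∈ T, (fun j => (x j : ℝ)) ∈ W) (hT : T.sum = 0)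
    (hirr : ∀ T' ≤ T, T' ≠ 0 → T'.sum = 0 → T' = T) :
    T.card ≤ T.toFinset.card * circuitBound (Module.finrank ℝ W) m := by
  have hrel : ∑ x : T.toFinset, T.count x.1 • x.1 = 0 := by
    rw [Finset.sum_coe_sort T.toFinset fun x => T.count x • x, ← Finset.sum_multiset_count, hT]
  have key := sum_le_card_mul_circuitBound (ι := T.toFinset) (f := Subtype.val) hm1
    (fun x => hm x (Multiset.mem_toFinset.1 x.2)) (fun x => hW x (Multiset.mem_toFinset.1 x.2))
    (l := fun x => T.count x.1) (fun x => Nat.cast_nonneg _)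
    (sum_nsmul_eq_zero_iff_sum_cast_smul_eq_zero.1 hrel) ?_ (S := Finset.univ) (by simp)
  · rw [← Nat.cast_sum, Finset.sum_coe_sort T.toFinset fun x => T.count x,
      Multiset.toFinset_sum_count_eq] at key
    simpa using key
  · intro c hc0 hcrel α hle
    by_contra! hα
    have hαc : ∀ x : T.toFinset, α * c x ≤ T.count x.1 := hle
    let T' : Multiset (κ → ℤ) := ∑ x : T.toFinset, Multiset.replicate (c x) x.1
    have hcount : ∀ x : T.toFinset, T'.count x.1 = c x := fun x => by
      simp [T', Multiset.count_sum', Multiset.count_replicate]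
    have hT'0 : T' ≠ 0 := fun h => hc0 (funext fun x => by simp [← hcount, h])
    have hT'sum : T'.sum = 0 := by
      rw [← hcrel]
      exact (map_sum Multiset.sumAddMonoidHom _ _).trans (by simp)
    have hT'le : T' ≤ T := Multiset.le_iff_count.2 fun x => by
      by_cases hx : x ∈ T'
      · obtain ⟨y, -, hy⟩ := Multiset.mem_sum.1 hx
        obtain rfl := Multiset.eq_of_mem_replicate hy
        rw [hcount]
        exact_mod_cast (le_mul_of_one_le_left (Nat.cast_nonneg _) hα.le).trans (hαc y)
      · simp [hx]
    obtain ⟨x, hx⟩ := Function.ne_iff.1 hc0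
    have hcx : (0 : ℝ) < c x := mod_cast Nat.pos_of_ne_zero hx
    refine (lt_mul_of_one_lt_left hcx hα).not_ge ((hαc x).trans_eq ?_)
    rw [← hcount x, hirr T' hT'le hT'0 hT'sum]

theorem exists_le_map_eq_of_le_map {α β : Type*} (φ : α → β) {s : Multiset α} {T : Multiset β}
    (hT : T ≤ s.map φ) : ∃ s' ≤ s, s'.map φ = T := by
  induction s using Multiset.induction_on generalizing T with
  | empty => exact ⟨0, le_rfl, by simpa [eq_comm] using hT⟩
  | cons a s ih =>
    classical
    rw [Multiset.map_cons] at hT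
    by_cases ha : φ a ∈ T
    · obtain ⟨s', hs', hmap⟩ := ih (Multiset.erase_le_iff_le_cons.2 hT)
      exact ⟨a ::ₘ s', Multiset.cons_le_cons a hs', by rw [Multiset.map_cons, hmap,
        Multiset.cons_erase ha]⟩
    · obtain ⟨s', hs', hmap⟩ := ih ((Multiset.le_cons_of_notMem ha).1 hT)
      exact ⟨s', hs'.trans (Multiset.le_cons_self s a), hmap⟩

end Relations

/-! ### Graver bases of stacked matrices -/

section FromRows

variable {p q n : Type*} [Fintype n] {U : Matrix p n ℤ} {L : Matrix q n ℤ} {v : n → ℤ}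

theorem fromRows_mulVec_eq_zero_iff :
    fromRows U L *ᵥ v = 0 ↔ U *ᵥ v = 0 ∧ L *ᵥ v = 0 := by
  rw [fromRows_mulVec, ← Sum.elim_zero_zero, Sum.elim_eq_iff]

theorem mulVec_multiset_sum (E : Matrix p n ℤ) (s : Multiset (n → ℤ)) :
    E *ᵥ s.sum = (s.map (E *ᵥ ·)).sum :=
  map_multiset_sum E.mulVecLin s

theorem eq_map_of_le_of_mem_graver_fromRows (hv : v ∈ graver (fromRows U L))
    {s : Multiset (n → ℤ)} (hs : ∀ u ∈ s, u ∈ graver L ∧ ConformalLE u v) (hsv : s.sum = v)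
    {T : Multiset (p → ℤ)} (hT : T ≤ s.map (U *ᵥ ·)) (hT0 : T ≠ 0) (hTsum : T.sum = 0) :
    T = s.map (U *ᵥ ·) := by
  obtain ⟨s', hs', rfl⟩ := exists_le_map_eq_of_le_map _ hT
  have hne : ∀ {t}, t ≤ s → t ≠ 0 → t.sum ≠ 0 := fun {t} hts ht h0 => by
    obtain ⟨u, hu⟩ := Multiset.exists_mem_of_ne_zero ht
    have hus := fun w hw => hs w (Multiset.mem_of_le hts hw)
    exact (hus u hu).1.1 (eq_zero_of_sum_eq_zero_of_conformalLE (fun w hw => (hus w hw).2) h0 hu)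
  have hL : L *ᵥ s'.sum = 0 := by
    rw [mulVec_multiset_sum]
    refine Multiset.sum_eq_zero fun y hy => ?_
    obtain ⟨u, hu, rfl⟩ := Multiset.mem_map.1 hy
    exact (hs u (Multiset.mem_of_le hs' hu)).1.2.1
  have hs'v : s'.sum = v := (mem_graver_iff_minimal.1 hv).2.2 _
    (hne hs' fun h => hT0 (by rw [h, Multiset.map_zero]))
    (fromRows_mulVec_eq_zero_iff.2 ⟨by rwa [mulVec_multiset_sum], hL⟩)
    (hsv ▸ conformalLE_sum_of_le (fun u hu => (hs u hu).2) hs')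
  obtain ⟨t, rfl⟩ := Multiset.le_iff_exists_add.1 hs'
  rw [Multiset.sum_add, hs'v, add_eq_left] at hsv
  rw [not_imp_not.1 (hne (Multiset.le_add_left t s')) hsv, add_zero]

theorem exists_finset_l1_le_of_mem_graver_fromRows [Finite p] [DecidableEq (p → ℤ)] {M : ℝ} {b : ℤ}
    (hM1 : 1 ≤ M) (hM : ∀ i j, |(U i j : ℝ)| ≤ M) (hb : ∀ u ∈ graver L, l1 u ≤ b)
    (hv : v ∈ graver (fromRows U L)) :
    ∃ S : Finset (n → ℤ), (∀ u ∈ S, u ∈ graver L ∧ ConformalLE u v) ∧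
      (l1 v : ℝ) ≤ (S.image (U *ᵥ ·)).card * circuitBound (U.map (Int.cast : ℤ → ℝ)).rank (M * b)
        * b := by
  classical
  obtain ⟨hvU, hvL⟩ := fromRows_mulVec_eq_zero_iff.1 hv.2.1
  obtain ⟨s, hs, hsv⟩ := exists_multiset_graver_sum_eq hvL
  have hb1 : (1 : ℝ) ≤ b := by
    obtain ⟨u, hu⟩ := exists_mem_graver_of_mulVec_eq_zero hv.1 hvL
    exact mod_cast (l1_pos hu.1).trans_le (hb u hu)
  have hcard : ((s.map (U *ᵥ ·)).card : ℝ) ≤ _ := card_le_card_toFinset_mul_circuitBound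
    (W := LinearMap.range (U.map (Int.cast : ℤ → ℝ)).mulVecLin) (m := M * b)
    (one_le_mul_of_one_le_of_one_le hM1 hb1) (Multiset.forall_mem_map_iff.2 fun u hu j => ?_)
    (Multiset.forall_mem_map_iff.2 fun u _ => ⟨fun i => u i, ?_⟩)
    (by rw [← mulVec_multiset_sum, hsv, hvU])
    (fun T => eq_map_of_le_of_mem_graver_fromRows hv hs hsv)
  · refine ⟨s.toFinset, fun u hu => hs u (Multiset.mem_toFinset.1 hu), ?_⟩
    rw [Multiset.card_map, Multiset.toFinset_map] at hcard
    have hl1 : (l1 v : ℝ) ≤ s.card * b := by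
      rw [← hsv]
      exact_mod_cast l1_multiset_sum_le fun u hu => hb u (hs u hu).1
    exact hl1.trans (mul_le_mul_of_nonneg_right hcard (zero_le_one.trans hb1))
  · refine (abs_mulVec_le U u hM j).trans (mul_le_mul_of_nonneg_left ?_ (zero_le_one.trans hM1))
    exact_mod_cast hb u (hs u hu).1
  · ext j
    simp [mulVec, dotProduct]

end FromRows

/-! ### Four-block matrices -/

theorem multichoose_mono_left {a b : ℕ} (hab : a ≤ b) (N : ℕ) :
    a.multichoose N ≤ b.multichoose N := by
  rw [Nat.multichoose_eq, Nat.multichoose_eq]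
  exact Nat.choose_le_choose _ (by omega)

theorem add_mul_multichoose_le_pow (N η : ℕ) : (N + η) * η.multichoose N ≤ (N + η) ^ η := by
  cases η with
  | zero => cases N <;> simp
  | succ η =>
    rw [Nat.multichoose_eq, pow_succ', ← Nat.choose_symm (by omega),
      show η + 1 + N - 1 - N = η by omega]
    gcongr
    exact (Nat.choose_le_pow _ _).trans (Nat.pow_le_pow_left (by omega) _)

theorem two_mul_multichoose_le_pow {N : ℕ} (hN : 1 ≤ N) (η : ℕ) :
    2 * η.multichoose N ≤ (N + η) ^ η := by
  obtain rfl | hη := Nat.eq_zero_or_pos η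
  · obtain ⟨N, rfl⟩ := Nat.exists_eq_add_of_le' hN
    simp
  · exact (Nat.mul_le_mul_right _ (by omega)).trans (add_mul_multichoose_le_pow N η)

theorem two_mul_card_le_card_of_conformalLE {n : Type*} {S X : Finset (n → ℤ)} {v : n → ℤ}
    (hS : ∀ u ∈ S, u ≠ 0 ∧ ConformalLE u v) (hSX : ∀ u ∈ S, u ∈ X ∧ -u ∈ X) :
    2 * S.card ≤ X.card := by
  classical
  have hdisj : Disjoint S (S.image (-·)) := Finset.disjoint_left.2 fun u hu hu' => by
    obtain ⟨w, hw, rfl⟩ := Finset.mem_image.1 hu'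
    exact (hS w hw).1 (eq_zero_of_conformalLE_of_conformalLE_neg (hS w hw).2 (hS _ hu).2)
  calc 2 * S.card = (S ∪ S.image (-·)).card := by
        rw [Finset.card_union_of_disjoint hdisj, Finset.card_image_of_injective _ neg_injective,
          two_mul]
    _ ≤ X.card := Finset.card_le_card (Finset.union_subset (fun u hu => (hSX u hu).1)
        (Finset.image_subset_iff.2 fun u hu => (hSX u hu).2))

section UpperMatrix

variable {dC nA nB N : ℕ} {C : Matrix (Fin dC) (Fin nB) ℤ} {D : Matrix (Fin dC) (Fin nA) ℤ}

theorem upperMatrix_mulVec (v : Fin nB ⊕ Fin nA × Fin N → ℤ) :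
    upperMatrix C D N *ᵥ v = C *ᵥ firstStage v + D *ᵥ ∑ k, brick v k := by
  ext i
  simp [upperMatrix, firstStage, brick, mulVec, dotProduct, fromCols, Fintype.sum_prod_type,
    Finset.mul_sum]

theorem abs_upperMatrix_le {M : ℝ} (hC : ∀ i j, |(C i j : ℝ)| ≤ M)
    (hD : ∀ i j, |(D i j : ℝ)| ≤ M) (i j) : |(upperMatrix C D N i j : ℝ)| ≤ M := by
  obtain j | p := j
  · exact hC i j
  · exact hD i p.1

theorem rank_upperMatrix_le_left : ((upperMatrix C D N).map (Int.cast : ℤ → ℝ)).rank ≤ dC :=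
  (rank_le_card_height _).trans_eq (Fintype.card_fin dC)

theorem rank_upperMatrix_le_right :
    ((upperMatrix C D N).map (Int.cast : ℤ → ℝ)).rank ≤ nB + nA := by
  have hsub : (upperMatrix C D N).map (Int.cast : ℤ → ℝ) =
      ((fromCols C D).map (Int.cast : ℤ → ℝ)).submatrix id (Sum.map id Prod.fst) := by
    ext i (j | p) <;> rfl
  rw [hsub]
  exact (rank_submatrix_le _ _ _).trans ((rank_le_card_width _).trans_eq (by simp))

variable {X : Finset (Fin nB → ℤ)} {Y : (Fin nB → ℤ) → Finset (Fin nA → ℤ)} {ξ η : ℕ}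
  {S : Finset (Fin nB ⊕ Fin nA × Fin N → ℤ)}

/-- The value at `(x, y¹, …, yᴺ)` depends only on `x` and the multiset of the `yᵏ`. -/
theorem card_image_upperMatrix_mulVec_le (hX : X.card ≤ ξ) (hY : ∀ x ∈ X, (Y x).card ≤ η)
    (hS : ∀ u ∈ S, firstStage u ∈ X ∧ ∀ k, brick u k ∈ Y (firstStage u)) :
    (S.image (upperMatrix C D N *ᵥ ·)).card ≤ ξ * η.multichoose N := by
  classical
  let value (x : Fin nB → ℤ) (t : Sym (Y x) N) : Fin dC → ℤ :=
    C *ᵥ x + D *ᵥ ((t : Multiset (Y x)).map Subtype.val).sum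
  have hsub : S.image (upperMatrix C D N *ᵥ ·) ⊆
      X.biUnion fun x => Finset.univ.image (value x) := Finset.image_subset_iff.2 fun u hu => by
    let t : Sym (Y (firstStage u)) N :=
      ⟨Finset.univ.val.map fun k => ⟨brick u k, (hS u hu).2 k⟩, by simp⟩
    refine Finset.mem_biUnion.2 ⟨_, (hS u hu).1, Finset.mem_image.2 ⟨t, Finset.mem_univ t, ?_⟩⟩
    simp only [value, t, Sym.coe_mk, Multiset.map_map, Function.comp_def, upperMatrix_mulVec]
    rfl
  refine (Finset.card_le_card hsub).trans ((Finset.card_biUnion_le_card_mul _ _ _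
    fun x hx => ?_).trans (Nat.mul_le_mul_right _ hX))
  calc (Finset.univ.image (value x)).card ≤ Fintype.card (Sym (Y x) N) := Finset.card_image_le
    _ = (Y x).card.multichoose N := by rw [Sym.card_sym_eq_multichoose, Fintype.card_coe]
    _ ≤ η.multichoose N := multichoose_mono_left (hY x hx) N

theorem card_image_upperMatrix_mulVec_le_card_image_firstStage
    {S : Finset (Fin nB ⊕ Fin nA × Fin 0 → ℤ)} :
    (S.image (upperMatrix C D 0 *ᵥ ·)).card ≤ (S.image firstStage).card := by
  have hfactor : S.image (upperMatrix C D 0 *ᵥ ·) = (S.image firstStage).image (C *ᵥ ·) := by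
    rw [Finset.image_image]
    exact Finset.image_congr fun u _ => by simp [upperMatrix_mulVec]
  exact hfactor ▸ Finset.card_image_le

end UpperMatrix

section Bounds

variable {dA dC nA nB N g ξ ξ' η : ℕ} {A : Matrix (Fin dA) (Fin nA) ℤ}
  {B : Matrix (Fin dA) (Fin nB) ℤ} {C : Matrix (Fin dC) (Fin nB) ℤ}
  {D : Matrix (Fin dC) (Fin nA) ℤ} {v : Fin nB ⊕ Fin nA × Fin N → ℤ} {M : ℝ}

theorem StochasticConstants.mono (h : StochasticConstants A B g ξ η) (hξ : ξ ≤ ξ') :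
    StochasticConstants A B g ξ' η := by
  obtain ⟨X, Y, hX, hY⟩ := h.building_blocks
  exact ⟨h.entry_le, h.l1_le, X, Y, hX.trans hξ, hY⟩

theorem StochasticConstants.one_le (h : StochasticConstants A B g ξ η)
    (hv : v ∈ graver (fourBlock A B C D N)) : (1 : ℝ) ≤ g ∧ (1 : ℝ) ≤ nB + N * nA := by
  obtain ⟨u, hu⟩ :=
    exists_mem_graver_of_mulVec_eq_zero hv.1 (fromRows_mulVec_eq_zero_iff.1 hv.2.1).2
  have hpos : 0 < (nB + N * nA) * g := by
    zify
    exact (l1_pos hu.1).trans_le (h.l1_le N u hu)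
  exact ⟨mod_cast Nat.pos_of_mul_pos_left hpos, mod_cast Nat.pos_of_mul_pos_right hpos⟩

theorem StochasticConstants.card_image_upperMatrix_mulVec_le (h : StochasticConstants A B g ξ η)
    {S : Finset (Fin nB ⊕ Fin nA × Fin N → ℤ)} (hS : ∀ u ∈ S, u ∈ graver (lowerMatrix A B N)) :
    (S.image (upperMatrix C D N *ᵥ ·)).card ≤ ξ * η.multichoose N := by
  obtain ⟨X, Y, hX, hY, hXY⟩ := h.building_blocks
  exact FourBlock.card_image_upperMatrix_mulVec_le hX hY fun u hu => hXY N u (hS u hu)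

/-- Without second stage, `S` and `-S` are disjoint sets of building blocks. -/
theorem StochasticConstants.two_mul_card_image_upperMatrix_zero_mulVec_le
    (h : StochasticConstants A B g ξ η) {S : Finset (Fin nB ⊕ Fin nA × Fin 0 → ℤ)}
    {v : Fin nB ⊕ Fin nA × Fin 0 → ℤ}
    (hS : ∀ u ∈ S, u ∈ graver (lowerMatrix A B 0) ∧ ConformalLE u v) :
    2 * (S.image (upperMatrix C D 0 *ᵥ ·)).card ≤ ξ := by
  obtain ⟨X, Y, hX, -, hXY⟩ := h.building_blocks
  have hhalf : 2 * (S.image firstStage).card ≤ X.card := by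
    refine two_mul_card_le_card_of_conformalLE (v := firstStage v) ?_ ?_ <;>
      refine Finset.forall_mem_image.2 fun u hu => ⟨?_, ?_⟩
    · exact fun h0 => (hS u hu).1.1 (funext (Sum.forall.2 ⟨congrFun h0, fun p => p.2.elim0⟩))
    · exact fun j => (hS u hu).2 (Sum.inl j)
    · exact (hXY 0 u (hS u hu).1).1
    · exact (hXY 0 (-u) (neg_mem_graver (hS u hu).1)).1
  exact (Nat.mul_le_mul_left 2 card_image_upperMatrix_mulVec_le_card_image_firstStage).trans
    (hhalf.trans hX)

theorem StochasticConstants.two_mul_card_image_upperMatrix_mulVec_le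
    (h : StochasticConstants A B g ξ η) {S : Finset (Fin nB ⊕ Fin nA × Fin N → ℤ)}
    (hS : ∀ u ∈ S, u ∈ graver (lowerMatrix A B N) ∧ ConformalLE u v) :
    2 * (S.image (upperMatrix C D N *ᵥ ·)).card ≤ ξ * (N + η) ^ η := by
  obtain rfl | hN := Nat.eq_zero_or_pos N
  · rw [zero_add]
    exact (h.two_mul_card_image_upperMatrix_zero_mulVec_le hS).trans
      (Nat.le_mul_of_pos_right ξ Nat.pow_self_pos)
  · calc 2 * (S.image (upperMatrix C D N *ᵥ ·)).card
        ≤ 2 * (ξ * η.multichoose N) := Nat.mul_le_mul_left 2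
          (h.card_image_upperMatrix_mulVec_le fun u hu => (hS u hu).1)
      _ = ξ * (2 * η.multichoose N) := by ring
      _ ≤ ξ * (N + η) ^ η := Nat.mul_le_mul_left ξ (two_mul_multichoose_le_pow hN η)

theorem StochasticConstants.exists_l1_le (h : StochasticConstants A B g ξ η) (hM : 1 ≤ M)
    (hC : ∀ i j, |(C i j : ℝ)| ≤ M) (hD : ∀ i j, |(D i j : ℝ)| ≤ M)
    (hv : v ∈ graver (fourBlock A B C D N)) :
    ∃ n : ℕ, 2 * n ≤ ξ * (N + η) ^ η ∧ (N + η) * n ≤ ξ * (N + η) ^ η ∧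
      (l1 v : ℝ) ≤ n * circuitBound ((upperMatrix C D N).map (Int.cast : ℤ → ℝ)).rank
        (M * ((nB + N * nA) * g)) * ((nB + N * nA) * g) := by
  obtain ⟨S, hS, hl1⟩ := exists_finset_l1_le_of_mem_graver_fromRows hM
    (abs_upperMatrix_le hC hD) (h.l1_le N) hv
  refine ⟨_, h.two_mul_card_image_upperMatrix_mulVec_le hS, ?_, by simpa using hl1⟩
  calc (N + η) * (S.image (upperMatrix C D N *ᵥ ·)).card
      ≤ (N + η) * (ξ * η.multichoose N) := Nat.mul_le_mul_left _
        (h.card_image_upperMatrix_mulVec_le fun u hu => (hS u hu).1)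
    _ = ξ * ((N + η) * η.multichoose N) := by ring
    _ ≤ ξ * (N + η) ^ η := Nat.mul_le_mul_left ξ (add_mul_multichoose_le_pow N η)

theorem StochasticConstants.l1_le_of_circuitBound_le (h : StochasticConstants A B g ξ η)
    (hM : 1 ≤ M) (hC : ∀ i j, |(C i j : ℝ)| ≤ M) (hD : ∀ i j, |(D i j : ℝ)| ≤ M)
    (hv : v ∈ graver (fourBlock A B C D N)) {Δ : ℝ}
    (hΔ : circuitBound ((upperMatrix C D N).map (Int.cast : ℤ → ℝ)).rank
      (M * ((nB + N * nA) * g)) ≤ 2 * Δ) :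
    (l1 v : ℝ) ≤ ξ * ((N : ℝ) + η) ^ η * Δ * (((nB : ℝ) + N * nA) * g) := by
  obtain ⟨n, hn, -, hl1⟩ := h.exists_l1_le hM hC hD hv
  have hn' : (2 * n : ℝ) ≤ ξ * ((N : ℝ) + η) ^ η := mod_cast hn
  have hΔ0 : 0 ≤ Δ := by
    have := (circuitBound_nonneg _ (by positivity)).trans hΔ
    linarith
  calc (l1 v : ℝ) ≤ n * (2 * Δ) * ((nB + N * nA) * g) := hl1.trans (by gcongr)
    _ = 2 * n * Δ * ((nB + N * nA) * g) := by ring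
    _ ≤ ξ * ((N : ℝ) + η) ^ η * Δ * (((nB : ℝ) + N * nA) * g) := by gcongr

theorem StochasticConstants.l1_le_of_one_le (h : StochasticConstants A B g ξ η)
    (hdC : 1 ≤ dC) (hM : 1 ≤ M) (hC : ∀ i j, |(C i j : ℝ)| ≤ M) (hD : ∀ i j, |(D i j : ℝ)| ≤ M)
    (hv : v ∈ graver (fourBlock A B C D N)) :
    (l1 v : ℝ) ≤ ξ * ((N : ℝ) + η) ^ η * dC * (√(dC : ℝ) * ((nB : ℝ) + N * nA) * M * g) ^ dC
      * (((nB : ℝ) + N * nA) * g) := by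
  obtain ⟨hg, hs⟩ := h.one_le hv
  have hm : 1 ≤ M * ((nB + N * nA) * g) :=
    one_le_mul_of_one_le_of_one_le hM (one_le_mul_of_one_le_of_one_le hs hg)
  refine (h.l1_le_of_circuitBound_le hM hC hD hv <|
    (circuitBound_mono rank_upperMatrix_le_left hm le_rfl).trans
      (circuitBound_le_two_mul hdC (zero_le_one.trans hm))).trans_eq ?_
  ring

/-- The rank of the upper blocks is at most `nB + nA`, so powers of `g` of that exponent can be
absorbed in `ξ`. -/
theorem StochasticConstants.l1_le_mul_pow_of_one_le (h : StochasticConstants A B g ξ η)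
    (hdC : 1 ≤ dC) (hM : 1 ≤ M) (hC : ∀ i j, |(C i j : ℝ)| ≤ M) (hD : ∀ i j, |(D i j : ℝ)| ≤ M)
    (hv : v ∈ graver (fourBlock A B C D N)) :
    (l1 v : ℝ) ≤ (ξ * (g + 1) ^ (nB + nA) : ℕ) * ((N : ℝ) + η) ^ η * dC
      * (√(dC : ℝ) * ((nB : ℝ) + N * nA) * M) ^ dC * (((nB : ℝ) + N * nA) * g) := by
  obtain ⟨hg, hs⟩ := h.one_le hv
  set r := ((upperMatrix C D N).map (Int.cast : ℤ → ℝ)).rank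
  have hm : 1 ≤ M * (nB + N * nA) := one_le_mul_of_one_le_of_one_le hM hs
  have hgr : (g : ℝ) ^ r ≤ (g + 1) ^ (nB + nA) :=
    (pow_le_pow_right₀ hg rank_upperMatrix_le_right).trans (by gcongr; linarith)
  have hbound : circuitBound r (M * ((nB + N * nA) * g)) ≤
      2 * ((g + 1) ^ (nB + nA) * (dC * (√dC * (M * (nB + N * nA))) ^ dC)) :=
    calc circuitBound r (M * ((nB + N * nA) * g))
        = g ^ r * circuitBound r (M * (nB + N * nA)) := by
          rw [← circuitBound_mul]
          ring_nf
      _ ≤ (g + 1) ^ (nB + nA) * (2 * (dC * (√dC * (M * (nB + N * nA))) ^ dC)) :=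
          mul_le_mul hgr ((circuitBound_mono rank_upperMatrix_le_left hm le_rfl).trans
            (circuitBound_le_two_mul hdC (zero_le_one.trans hm)))
            (circuitBound_nonneg _ (zero_le_one.trans hm)) (by positivity)
      _ = _ := mul_left_comm _ _ _
  refine (h.l1_le_of_circuitBound_le hM hC hD hv hbound).trans_eq ?_
  push_cast
  ring

theorem exists_one_le_abs_le (C : Matrix (Fin dC) (Fin nB) ℤ) (D : Matrix (Fin dC) (Fin nA) ℤ) :
    ∃ M : ℝ, 1 ≤ M ∧ (∀ i j, |(C i j : ℝ)| ≤ M) ∧ ∀ i j, |(D i j : ℝ)| ≤ M := by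
  obtain ⟨a, ha⟩ := exists_nat_abs_le_of_finset (Finset.univ.image (fromCols C D))
  have hrow : ∀ i j, |((fromCols C D i j : ℤ) : ℝ)| ≤ max 1 (a : ℝ) := fun i j =>
    le_max_of_le_right (mod_cast ha _ (Finset.mem_image_of_mem _ (Finset.mem_univ i)) j)
  exact ⟨max 1 a, le_max_left _ _, fun i j => hrow i (Sum.inl j), fun i j => hrow i (Sum.inr j)⟩

theorem StochasticConstants.exists_l1_le_mul_pow (h : StochasticConstants A B g ξ η)
    (C : Matrix (Fin dC) (Fin nB) ℤ) (D : Matrix (Fin dC) (Fin nA) ℤ) :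
    ∃ K : ℝ, ∀ N : ℕ, 1 ≤ N → ∀ v ∈ graver (fourBlock A B C D N),
      (l1 v : ℝ) ≤ K * (N : ℝ) ^ (dC + η) := by
  obtain ⟨M, hM, hC, hD⟩ := exists_one_le_abs_le C D
  refine ⟨ξ * (1 + η) ^ η * circuitBound dC (M * ((nB + nA) * g)) * ((nB + nA) * g),
    fun N hN v hv => ?_⟩
  obtain ⟨n, -, hn, hl1⟩ := h.exists_l1_le hM hC hD hv
  set r := ((upperMatrix C D N).map (Int.cast : ℤ → ℝ)).rank
  obtain ⟨hg, hs⟩ := h.one_le hv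
  have hN' : (1 : ℝ) ≤ N := mod_cast hN
  have hsN : (nB : ℝ) + N * nA ≤ N * (nB + nA) := by nlinarith [(nB.cast_nonneg : (0 : ℝ) ≤ nB)]
  have hNn : (N : ℝ) * n ≤ ξ * (N * (1 + η)) ^ η := by
    norm_cast
    calc N * n ≤ (N + η) * n := Nat.mul_le_mul_right n (Nat.le_add_right N η)
      _ ≤ ξ * (N + η) ^ η := hn
      _ ≤ ξ * (N * (1 + η)) ^ η := by
        gcongr
        nlinarith
  have hm : 1 ≤ M * ((nB + N * nA) * g) :=
    one_le_mul_of_one_le_of_one_le hM (one_le_mul_of_one_le_of_one_le hs hg)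
  have hcircuit : circuitBound r (M * ((nB + N * nA) * g)) ≤
      N ^ dC * circuitBound dC (M * ((nB + nA) * g)) := by
    refine (circuitBound_mono rank_upperMatrix_le_left hm
      (m' := N * (M * ((nB + nA) * g))) ?_).trans_eq (circuitBound_mul _ _ _)
    calc M * ((nB + N * nA) * g) ≤ M * (N * (nB + nA) * g) := by gcongr
      _ = N * (M * ((nB + nA) * g)) := by ring
  have hnonneg := circuitBound_nonneg r (zero_le_one.trans hm)
  refine le_of_mul_le_mul_left ?_ (zero_lt_one.trans_le hN')
  calc N * (l1 v : ℝ)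
      ≤ N * (n * circuitBound r (M * ((nB + N * nA) * g)) * ((nB + N * nA) * g)) := by gcongr
    _ = N * n * circuitBound r (M * ((nB + N * nA) * g)) * ((nB + N * nA) * g) := by ring
    _ ≤ ξ * (N * (1 + η)) ^ η * (N ^ dC * circuitBound dC (M * ((nB + nA) * g))) *
        (N * (nB + nA) * g) := by
        have := hnonneg.trans hcircuit
        gcongr
    _ = _ := by
        rw [mul_pow, pow_add]
        ring

end Bounds

end FourBlock

theorem mainTheorem2 {dA nA nB : ℕ}
    (A : Matrix (Fin dA) (Fin nA) ℤ) (B : Matrix (Fin dA) (Fin nB) ℤ) :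
    -- the constants of the structure theorem exist
    (∃ g ξ η : ℕ, FourBlock.StochasticConstants A B g ξ η) ∧
    ∀ g ξ₀ η : ℕ, FourBlock.StochasticConstants A B g ξ₀ η →
      -- the bound, after possibly enlarging `ξ₀` to a `ξ` that depends only on `A`, `B`
      -- and the given constants
      (∃ ξ : ℕ, ξ₀ ≤ ξ ∧ FourBlock.StochasticConstants A B g ξ η ∧
        ∀ (dC : ℕ), 1 ≤ dC →
        ∀ (C : Matrix (Fin dC) (Fin nB) ℤ) (D : Matrix (Fin dC) (Fin nA) ℤ) (M : ℝ), 1 ≤ M →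
        (∀ i j, |(C i j : ℝ)| ≤ M) → (∀ i j, |(D i j : ℝ)| ≤ M) →
        ∀ (N : ℕ), ∀ v ∈ FourBlock.graver (FourBlock.fourBlock A B C D N),
          (FourBlock.l1 v : ℝ) ≤
            ξ * ((N : ℝ) + η) ^ η * dC * (√(dC : ℝ) * ((nB : ℝ) + N * nA) * M) ^ dC
              * (((nB : ℝ) + N * nA) * g)) ∧
      -- the bound for arbitrary constants of the structure theorem
      (∀ (dC : ℕ), 1 ≤ dC →
        ∀ (C : Matrix (Fin dC) (Fin nB) ℤ) (D : Matrix (Fin dC) (Fin nA) ℤ) (M : ℝ), 1 ≤ M →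
        (∀ i j, |(C i j : ℝ)| ≤ M) → (∀ i j, |(D i j : ℝ)| ≤ M) →
        ∀ (N : ℕ), ∀ v ∈ FourBlock.graver (FourBlock.fourBlock A B C D N),
          (FourBlock.l1 v : ℝ) ≤
            ξ₀ * ((N : ℝ) + η) ^ η * dC * (√(dC : ℝ) * ((nB : ℝ) + N * nA) * M * g) ^ dC
              * (((nB : ℝ) + N * nA) * g)) ∧
      -- for fixed blocks the norms are `O(N ^ (dC + η))`
      (∀ (dC : ℕ) (C : Matrix (Fin dC) (Fin nB) ℤ) (D : Matrix (Fin dC) (Fin nA) ℤ),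
        ∃ K : ℝ, ∀ (N : ℕ), 1 ≤ N →
          ∀ v ∈ FourBlock.graver (FourBlock.fourBlock A B C D N),
            (FourBlock.l1 v : ℝ) ≤ K * (N : ℝ) ^ (dC + η)) := by
  refine ⟨FourBlock.exists_stochasticConstants A B, fun g ξ₀ η h =>
    ⟨⟨ξ₀ * (g + 1) ^ (nB + nA), ?_, h.mono ?_, ?_⟩, ?_, ?_⟩⟩
  · exact Nat.le_mul_of_pos_right ξ₀ (by positivity)
  · exact Nat.le_mul_of_pos_right ξ₀ (by positivity)
  · exact fun dC hdC C D M hM hC hD N v hv => h.l1_le_mul_pow_of_one_le hdC hM hC hD hv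
  · exact fun dC hdC C D M hM hC hD N v hv => h.l1_le_of_one_le hdC hM hC hD hv
  · exact fun dC C D => h.exists_l1_le_mul_pow C D
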